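/- For $q\ge 1$, $d\in\{1,2,\dots\}$ and $t>0$ put $B_t^q=\{x\in\mathbb{R}^d:\sum_{i=1}^d|x_i|^q\le t^q\}$ and $\kappa_q(d,t)=t\,d^{-1/q}$. Identify $\mathbb{T}^d$ with $[-\tfrac12,\tfrac12)^d$ and for $\xi\in\mathbb{T}^d$ let $$\|\xi\|=\Big(\sum_{j=1}^d\sin^2(\pi\xi_j)\Big)^{1/2},\qquad \|\xi+1/2\|=\Big(\sum_{j=1}^d\cos^2(\pi\xi_j)\Big)^{1/2},$$ $$m_t^q(\xi)=\frac{1}{|B_t^q\cap\mathbb{Z}^d|}\sum_{x\in B_t^q\cap\mathbb{Z}^d}e^{2\pi i\,x\cdot\xi},\qquad \lambda_t^{1,q}(\xi)=e^{-\kappa_q(d,t)^q\|\xi\|^2},$$ $$\lambda_t^{2,q}(\xi)=\frac{1}{|B_t^q\cap\mathbb{Z}^d|}\Big(\sum_{x\in B_t^q\cap\mathbb{Z}^d}(-1)^{\sum_{i=1}^d x_i}\Big)e^{-\kappa_q(d,t)^q\|\xi+1/2\|^2}.$$ There is an absolute constant $C>0$ such that for all real $q\ge1$, all integers $d,N\ge1$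 with $\kappa_q(d,N)\le e^{-12/q}$, and all $\xi\in\mathbb{T}^d$, the following hold. (1) If $\|\xi\|\le\|\xi+1/2\|$, then $$|m_N^q(\xi)-\lambda_N^{1,q}(\xi)|\le C\Big(\min\big(\kappa_q(d,N)^q\|\xi\|^2,\ (\kappa_q(d,N)^q\|\xi\|^2)^{-1}\big)+\kappa_q(d,N)^{q/50}+N^{-q}\Big).$$ (2) If $\|\xi+1/2\|<\|\xi\|$, then $$|m_N^q(\xi)-\lambda_N^{2,q}(\xi)|\le C\Big(\min\big(\kappa_q(d,N)^q\|\xi+1/2\|^2,\ (\kappa_q(d,N)^q\|\xi+1/2\|^2)^{-1}\big)+\kappa_q(d,N)^{q/50}+N^{-q}\Big).$$ Here a minimum $\min(0,0^{-1})$ is read as $0$. -/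

import Mathlib

noncomputable section

namespace LqBall

/-- The `d`-dimensional torus, identified with `[-1/2, 1/2)^d`. -/
def torus (d : ℕ) : Set (Fin d → ℝ) :=
  {ξ | ∀ i, ξ i ∈ Set.Ico (-(1 / 2) : ℝ) (1 / 2)}

/-- The closed `ℓ^q` ball `B_t^q` of radius `t` in `ℝ^d`. -/
def ball (q : ℝ) (d : ℕ) (t : ℝ) : Set (Fin d → ℝ) :=
  {x | ∑ i, |x i| ^ q ≤ t ^ q}

/-- The set `B_t^q ∩ ℤ^d`. -/
def latticeBall (q : ℝ) (d : ℕ) (t : ℝ) : Set (Fin d → ℤ) :=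
  {x | (fun i => (x i : ℝ)) ∈ ball q d t}

/-- `B_t^q ∩ ℤ^d` is finite, so the cardinalities and sums below are genuine ones. -/
theorem latticeBall_finite {q : ℝ} (hq : 1 ≤ q) (d : ℕ) {t : ℝ} (ht : 0 ≤ t) :
    (latticeBall q d t).Finite := by
  have hq0 : 0 < q := by linarith
  refine (Set.Finite.pi' (fun _ : Fin d => Set.finite_Icc (-⌊t⌋) ⌊t⌋)).subset ?_
  intro x hx i
  have h1 : |(x i : ℝ)| ^ q ≤ t ^ q := by
    refine le_trans ?_ hx
    exact Finset.single_le_sum (f := fun j => |(x j : ℝ)| ^ q)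
      (fun j _ => Real.rpow_nonneg (abs_nonneg _) q) (Finset.mem_univ i)
  have h2 : |(x i : ℝ)| ≤ t := (Real.rpow_le_rpow_iff (abs_nonneg _) ht hq0).1 h1
  have h3 : |x i| ≤ ⌊t⌋ := by
    rw [Int.le_floor]
    push_cast
    exact h2
  exact Set.mem_Icc.2 (abs_le.1 h3)

/-- `κ_q(d,t) = t / d^{1/q}`. -/
def kappa (q : ℝ) (d : ℕ) (t : ℝ) : ℝ :=
  t / (d : ℝ) ^ (1 / q)

/-- `‖ξ‖ = (∑_j sin²(π ξ_j))^{1/2}`; it is 1-periodic in every coordinate. -/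
def tnorm {d : ℕ} (ξ : Fin d → ℝ) : ℝ :=
  Real.sqrt (∑ j, Real.sin (Real.pi * ξ j) ^ 2)

/-- `ξ + 1/2 = (ξ_1 + 1/2, …, ξ_d + 1/2)`. -/
def halfShift {d : ℕ} (ξ : Fin d → ℝ) : Fin d → ℝ :=
  fun j => ξ j + 1 / 2

/-- `e(s) = e^{2πis}`. -/
def e (s : ℝ) : ℂ :=
  Complex.exp (2 * Real.pi * Complex.I * s)

/-- The multiplier `m_t^q(ξ)`, the average of `e(x · ξ)` over `x ∈ B_t^q ∩ ℤ^d`. -/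
def mult (q : ℝ) {d : ℕ} (t : ℝ) (ξ : Fin d → ℝ) : ℂ :=
  (1 / ((latticeBall q d t).ncard : ℂ)) *
    ∑ᶠ x ∈ latticeBall q d t, e (∑ i, (x i : ℝ) * ξ i)

/-- `λ_t^{1,q}(ξ) = exp(-κ_q(d,t)^q ‖ξ‖²)`. -/
def lambda1 (q : ℝ) {d : ℕ} (t : ℝ) (ξ : Fin d → ℝ) : ℂ :=
  (Real.exp (-(kappa q d t ^ q * tnorm ξ ^ 2)) : ℂ)

/-- `λ_t^{2,q}(ξ)`, the average of `(-1)^{x_1 + ⋯ + x_d}` over `x ∈ B_t^q ∩ ℤ^d` times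
`exp(-κ_q(d,t)^q ‖ξ + 1/2‖²)`. -/
def lambda2 (q : ℝ) {d : ℕ} (t : ℝ) (ξ : Fin d → ℝ) : ℂ :=
  (1 / ((latticeBall q d t).ncard : ℂ)) *
    (∑ᶠ x ∈ latticeBall q d t, (-1 : ℂ) ^ (∑ i, x i)) *
    (Real.exp (-(kappa q d t ^ q * tnorm (halfShift ξ) ^ 2)) : ℂ)

end LqBall

end


/-!
With `n = t^q` and `K = n / d = κ^q`, lowering the level `n` of the ball by one divides the number
of lattice points by at least `1 / (2K)`: each zero coordinate of a point of the smaller ball may be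
raised to one. Hence large coordinates are rare, `x_i²` has mean `O(K)`, and all but a proportion
`O(K)` of the points have at least `n / 2` coordinates equal to `±1`.

Averaging over sign changes turns the multiplier into the mean of `∏ cos (2π x_i ξ_i)`, and
`|1 - ∏ cos (2π x_i ξ_i)| ≤ 2 ∑ x_i² sin² (π ξ_i)` gives the approximation for small `K ‖ξ‖²`. For
large `K ‖ξ‖²`, average over permutations of the coordinates: match each coordinate `±1` of `x`
with a zero coordinate and symmetrize over these disjoint transpositions, so that every matched
pair, sitting at frequencies `ξ_u, ξ_v` after the permutation, contributes
`(cos 2πξ_u + cos 2πξ_v) / 2` to the product. Its absolute value is at most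
`exp (-(1 - cos 2πξ_u cos 2πξ_v) / 4)`, and the second moment method shows that the sum of these
exponents is typically of order `K min(‖ξ‖², ‖ξ + 1/2‖²)`. The case of the half-integer shift is
the same one after factoring `(-1)^{∑ x_i}` out of the product.
-/

noncomputable section

namespace LqBall

open Finset
open scoped BigOperators

section Counting

variable {ι : Type*} {q n : ℝ}

lemma sum_pow_natAbs_le {r : ℝ} (hr0 : 0 ≤ r) (hr : r ≤ 1 / 2) {a : ℕ} {s : Finset ℤ}
    (hs : ∀ j ∈ s, a ≤ j.natAbs) : ∑ j ∈ s, r ^ j.natAbs ≤ 4 * r ^ a := by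
  obtain ⟨M, hM⟩ := (s.image Int.natAbs).exists_nat_subset_range
  have hmaps : ∀ j ∈ s, j.natAbs ∈ Ico a M := fun j hj =>
    mem_Ico.2 ⟨hs j hj, mem_range.1 (hM (mem_image_of_mem _ hj))⟩
  have hfiber (k : ℕ) : (#{j ∈ s | j.natAbs = k} : ℝ) ≤ 2 := by
    have hsub : ({j ∈ s | j.natAbs = k} : Finset ℤ) ⊆ {(k : ℤ), -(k : ℤ)} := fun j hj => by
      simpa using Int.natAbs_eq_iff.1 (mem_filter.1 hj).2
    exact mod_cast (card_le_card hsub).trans card_le_two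
  calc ∑ j ∈ s, r ^ j.natAbs = ∑ k ∈ Ico a M, ∑ j ∈ s with j.natAbs = k, r ^ j.natAbs :=
        (sum_fiberwise_of_maps_to hmaps _).symm
    _ = ∑ k ∈ Ico a M, #{j ∈ s | j.natAbs = k} * r ^ k := by
        refine sum_congr rfl fun k _ => ?_
        rw [sum_congr rfl fun j hj => by rw [(mem_filter.1 hj).2], sum_const, nsmul_eq_mul]
    _ ≤ ∑ k ∈ Ico a M, 2 * r ^ k := by gcongr with k; exact hfiber k
    _ = 2 * ∑ k ∈ Ico a M, r ^ k := (mul_sum _ _ _).symm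
    _ ≤ 2 * (r ^ a / (1 - r)) := by
        gcongr; exact geom_sum_Ico_le_of_lt_one hr0 (by linarith)
    _ ≤ 2 * (2 * r ^ a) := by
        gcongr
        rw [div_le_iff₀ (by linarith)]
        nlinarith [pow_nonneg hr0 a]
    _ = 4 * r ^ a := by ring

lemma injOn_update [DecidableEq ι] (i : ι) (a b : ℤ) :
    Set.InjOn (fun x : ι → ℤ => Function.update x i b) {x | x i = a} :=
  Set.LeftInvOn.injOn (f₁' := (Function.update · i a)) (by rintro x rfl; simp)

variable [Fintype ι]

/-- The `q`-th power `∑ |x_i|^q` of the `ℓ^q` norm of a lattice point. -/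
def powSum (q : ℝ) (x : ι → ℤ) : ℝ := ∑ i, |(x i : ℝ)| ^ q

lemma abs_le_abs_rpow (hq : 1 ≤ q) (j : ℤ) : |(j : ℝ)| ≤ |(j : ℝ)| ^ q := by
  rcases eq_or_ne j 0 with rfl | hj
  · simpa using Real.rpow_nonneg le_rfl q
  · exact Real.self_le_rpow_of_one_le (mod_cast Int.one_le_abs hj) hq

lemma natAbs_le_floor_abs_rpow (hq : 1 ≤ q) (j : ℤ) : j.natAbs ≤ ⌊|(j : ℝ)| ^ q⌋₊ :=
  Nat.le_floor (by simpa [Nat.cast_natAbs] using abs_le_abs_rpow hq j)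

lemma abs_rpow_le_powSum (x : ι → ℤ) (i : ι) : |(x i : ℝ)| ^ q ≤ powSum q x :=
  single_le_sum (f := fun i => |(x i : ℝ)| ^ q) (fun _ _ => by positivity) (mem_univ i)

lemma card_support_le_powSum (hq : 1 ≤ q) (x : ι → ℤ) :
    (#{i | x i ≠ 0} : ℝ) ≤ powSum q x := by
  rw [natCast_card_filter, powSum]
  refine sum_le_sum fun i _ => ?_
  split_ifs with h
  · exact le_trans (mod_cast Int.one_le_abs h) (abs_le_abs_rpow hq (x i))
  · positivity

/-- The part of `∑ |x_i|^q` carried by the coordinates of absolute value at least two. -/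
def tailSum (q : ℝ) (x : ι → ℤ) : ℝ := ∑ i, if 2 ≤ (x i).natAbs then |(x i : ℝ)| ^ q else 0

/-- The set of coordinates of absolute value one. -/
def ones (x : ι → ℤ) : Finset ι := {i | (x i).natAbs = 1}

lemma powSum_eq_card_ones_add_tailSum (hq : 1 ≤ q) (x : ι → ℤ) :
    powSum q x = #(ones x) + tailSum q x := by
  have hq0 : q ≠ 0 := by linarith
  rw [ones, natCast_card_filter, tailSum, ← sum_add_distrib, powSum]
  refine sum_congr rfl fun i _ => ?_
  rw [← Int.cast_abs, ← Nat.cast_natAbs]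
  rcases (x i).natAbs with _ | _ | k
  · simp [hq0]
  · simp
  · simp

variable [DecidableEq ι]

lemma powSum_update (x : ι → ℤ) (i : ι) (j : ℤ) :
    powSum q (Function.update x i j) = powSum q x - |(x i : ℝ)| ^ q + |(j : ℝ)| ^ q := by
  have hupdate : (fun k => |(Function.update x i j k : ℝ)| ^ q)
      = Function.update (fun k => |(x k : ℝ)| ^ q) i (|(j : ℝ)| ^ q) := by
    ext k
    rcases eq_or_ne k i with rfl | hk <;> simp [*]
  have hsplit := sum_sdiff (f := fun k => |(x k : ℝ)| ^ q) (subset_univ {i})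
  rw [sum_singleton] at hsplit
  rw [powSum, hupdate, sum_update_of_mem (mem_univ i), powSum, ← hsplit]
  ring

/-- The finset of lattice points with `∑ |x_i|^q ≤ n`. It is parametrized by the level `n = t^q`
instead of the radius `t`, because the arguments below lower the level by integers. The box only
serves to produce a finset, see `mem_powBall`. -/
def powBall (ι : Type*) [Fintype ι] [DecidableEq ι] (q n : ℝ) : Finset (ι → ℤ) :=
  {x ∈ Fintype.piFinset fun _ => Icc (-⌊n⌋) ⌊n⌋ | powSum q x ≤ n}

lemma mem_powBall (hq : 1 ≤ q) {x : ι → ℤ} : x ∈ powBall ι q n ↔ powSum q x ≤ n := by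
  simp only [powBall, mem_filter, Fintype.mem_piFinset, and_iff_right_iff_imp]
  intro hx i
  rw [mem_Icc, ← abs_le, Int.le_floor, Int.cast_abs]
  exact (abs_le_abs_rpow hq (x i)).trans ((abs_rpow_le_powSum x i).trans hx)

lemma powBall_nonempty (hq : 1 ≤ q) (hn : 0 ≤ n) : (powBall ι q n).Nonempty :=
  ⟨0, (mem_powBall hq).2 (by simpa [powSum, Real.zero_rpow (by linarith : q ≠ 0)] using hn)⟩

lemma card_powBall_sub_one_zero_le (hq : 1 ≤ q) (k : ι) :
    #{x ∈ powBall ι q (n - 1) | x k = 0} ≤ #{y ∈ powBall ι q n | y k ≠ 0} := by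
  have hq0 : q ≠ 0 := by linarith
  refine card_le_card_of_injOn (fun x => Function.update x k 1) ?_
    ((injOn_update k 0 1).mono fun x hx => (mem_filter.1 hx).2)
  intro x hx
  simp only [coe_filter, Set.mem_ofPred_eq, mem_powBall hq] at hx ⊢
  simp only [powSum_update, hx.2, Function.update_self]
  simpa [Real.zero_rpow hq0, ← le_sub_iff_add_le] using hx.1

-- Count the pairs of a point and a coordinate where the entry `0` gets replaced by `1`.
lemma card_powBall_sub_one_mul_le (hq : 1 ≤ q) :
    (#(powBall ι q (n - 1)) : ℝ) * (Fintype.card ι - n) ≤ #(powBall ι q n) * n := by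
  have hzeros : ∀ x ∈ powBall ι q (n - 1), (Fintype.card ι : ℝ) - n ≤ #{k | x k = 0} := by
    intro x hx
    have hsupp := (card_support_le_powSum hq x).trans ((mem_powBall hq).1 hx)
    have hsplit := card_filter_add_card_filter_not (s := univ) fun k => x k = 0
    rw [card_univ] at hsplit
    rw [← hsplit]
    push_cast
    linarith
  have hdouble (p : ℤ → Prop) [DecidablePred p] (s : Finset (ι → ℤ)) :
      ∑ x ∈ s, (#{k | p (x k)} : ℝ) = ∑ k, (#{x ∈ s | p (x k)} : ℝ) :=
    mod_cast sum_card_bipartiteAbove_eq_sum_card_bipartiteBelow fun (x : ι → ℤ) k => p (x k)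
  calc (#(powBall ι q (n - 1)) : ℝ) * (Fintype.card ι - n)
      ≤ ∑ x ∈ powBall ι q (n - 1), (#{k | x k = 0} : ℝ) := by
        simpa using card_nsmul_le_sum _ _ _ hzeros
    _ = ∑ k, (#{x ∈ powBall ι q (n - 1) | x k = 0} : ℝ) := hdouble (· = 0) _
    _ ≤ ∑ k, (#{y ∈ powBall ι q n | y k ≠ 0} : ℝ) :=
        sum_le_sum fun k _ => mod_cast card_powBall_sub_one_zero_le hq k
    _ = ∑ y ∈ powBall ι q n, (#{k | y k ≠ 0} : ℝ) := (hdouble (· ≠ 0) _).symm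
    _ ≤ #(powBall ι q n) * n := by
        simpa using sum_le_card_nsmul _ _ _ fun y hy =>
          (card_support_le_powSum hq y).trans ((mem_powBall hq).1 hy)

variable [Nonempty ι]

lemma card_powBall_sub_nat_le (hq : 1 ≤ q) (hn : 0 ≤ n) (hK : n / Fintype.card ι ≤ 1 / 2)
    (m : ℕ) :
    (#(powBall ι q (n - m)) : ℝ) ≤ (2 * (n / Fintype.card ι)) ^ m * #(powBall ι q n) := by
  have hd : (0 : ℝ) < Fintype.card ι := mod_cast Fintype.card_pos
  induction m with
  | zero => simp
  | succ m ih =>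
    have hshift := card_powBall_sub_one_mul_le (ι := ι) (n := n - m) hq
    rw [div_le_iff₀ hd] at hK
    have hstep : (#(powBall ι q (n - m - 1)) : ℝ)
        ≤ 2 * (n / Fintype.card ι) * #(powBall ι q (n - m)) := by
      rw [mul_div_assoc', div_mul_eq_mul_div, le_div_iff₀ hd]
      have hhalf : (Fintype.card ι : ℝ) / 2 ≤ Fintype.card ι - (n - m) := by
        linarith [(m.cast_nonneg : (0 : ℝ) ≤ m)]
      have hdrop := mul_le_mul_of_nonneg_left hhalf
        (#(powBall ι q (n - m - 1))).cast_nonneg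
      have hlevel : (#(powBall ι q (n - m)) : ℝ) * (n - m) ≤ #(powBall ι q (n - m)) * n := by
        gcongr; simp
      linarith
    calc (#(powBall ι q (n - (m + 1 : ℕ))) : ℝ)
        ≤ 2 * (n / Fintype.card ι) * #(powBall ι q (n - m)) := by
          rwa [Nat.cast_succ, ← sub_sub]
      _ ≤ 2 * (n / Fintype.card ι) * ((2 * (n / Fintype.card ι)) ^ m * #(powBall ι q n)) := by
          gcongr
      _ = _ := by ring

lemma card_coord_eq_le (hq : 1 ≤ q) (hn : 0 ≤ n) (hK : n / Fintype.card ι ≤ 1 / 2)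
    (i : ι) (j : ℤ) :
    (#{x ∈ powBall ι q n | x i = j} : ℝ)
      ≤ (2 * (n / Fintype.card ι)) ^ ⌊|(j : ℝ)| ^ q⌋₊ * #(powBall ι q n) := by
  have hq0 : q ≠ 0 := by linarith
  refine le_trans ?_ (card_powBall_sub_nat_le hq hn hK _)
  refine Nat.cast_le.2 (card_le_card_of_injOn (fun x => Function.update x i 0) ?_
    ((injOn_update i j 0).mono fun x hx => (mem_filter.1 hx).2))
  intro x hx
  simp only [coe_filter, Set.mem_ofPred_eq, mem_powBall hq, mem_coe] at hx ⊢
  have hfloor : (⌊|(j : ℝ)| ^ q⌋₊ : ℝ) ≤ |(j : ℝ)| ^ q := Nat.floor_le (by positivity)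
  simp only [powSum_update, hx.2, Int.cast_zero, abs_zero, Real.zero_rpow hq0]
  linarith [hx.1]

lemma expect_exp_coord_le (hq : 1 ≤ q) (hn : 0 ≤ n) (hK : n / Fintype.card ι ≤ 1 / 16)
    (i : ι) (a : ℕ) :
    𝔼 x ∈ powBall ι q n, (if a ≤ (x i).natAbs then (4 : ℝ) ^ ⌊|(x i : ℝ)| ^ q⌋₊ else 0)
      ≤ 4 * (8 * (n / Fintype.card ι)) ^ a := by
  set B := powBall ι q n
  set K := n / Fintype.card ι
  have hK0 : 0 ≤ K := by positivity
  set s := B.filter fun x => a ≤ (x i).natAbs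
  have hcoord (j : ℤ) : ∑ x ∈ s with x i = j, (4 : ℝ) ^ ⌊|(x i : ℝ)| ^ q⌋₊
      ≤ (8 * K) ^ j.natAbs * #B := by
    set m := ⌊|(j : ℝ)| ^ q⌋₊
    calc ∑ x ∈ s with x i = j, (4 : ℝ) ^ ⌊|(x i : ℝ)| ^ q⌋₊
        = #{x ∈ s | x i = j} * (4 : ℝ) ^ m := by
          rw [sum_congr rfl fun x hx => by rw [(mem_filter.1 hx).2], sum_const, nsmul_eq_mul]
      _ ≤ #{x ∈ B | x i = j} * (4 : ℝ) ^ m := by gcongr; exact filter_subset _ _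
      _ ≤ (2 * K) ^ m * #B * (4 : ℝ) ^ m := by
          gcongr; exact card_coord_eq_le hq hn (hK.trans (by norm_num)) i j
      _ = (8 * K) ^ m * #B := by
          rw [show 8 * K = 2 * K * 4 by ring, mul_pow _ (4 : ℝ)]; ring
      _ ≤ (8 * K) ^ j.natAbs * #B := by
          gcongr ?_ * _
          exact pow_le_pow_of_le_one (by positivity) (by linarith) (natAbs_le_floor_abs_rpow hq j)
  rw [expect_eq_sum_div_card]
  refine div_le_of_le_mul₀ (by positivity) (by positivity) ?_
  calc ∑ x ∈ B, (if a ≤ (x i).natAbs then (4 : ℝ) ^ ⌊|(x i : ℝ)| ^ q⌋₊ else 0)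
      = ∑ j ∈ s.image (· i), ∑ x ∈ s with x i = j, (4 : ℝ) ^ ⌊|(x i : ℝ)| ^ q⌋₊ := by
        rw [← sum_filter, sum_fiberwise_of_maps_to fun x hx => mem_image_of_mem _ hx]
    _ ≤ ∑ j ∈ s.image (· i), (8 * K) ^ j.natAbs * #B := sum_le_sum fun j _ => hcoord j
    _ = (∑ j ∈ s.image (· i), (8 * K) ^ j.natAbs) * #B := (sum_mul _ _ _).symm
    _ ≤ 4 * (8 * K) ^ a * #B := by
        gcongr
        refine sum_pow_natAbs_le (by positivity) (by linarith) ?_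
        rintro _ hj
        obtain ⟨x, hx, rfl⟩ := mem_image.1 hj
        exact (mem_filter.1 hx).2

lemma expect_sq_coord_le (hq : 1 ≤ q) (hn : 0 ≤ n) (hK : n / Fintype.card ι ≤ 1 / 16) (i : ι) :
    𝔼 x ∈ powBall ι q n, (x i : ℝ) ^ 2 ≤ 32 * (n / Fintype.card ι) := by
  refine (expect_le_expect fun x _ => ?_).trans
    ((expect_exp_coord_le hq hn hK i 1).trans_eq (by ring))
  split_ifs with hx
  · have hpow : |(x i : ℝ)| ≤ 2 ^ ⌊|(x i : ℝ)| ^ q⌋₊ := by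
      have hnat := (natAbs_le_floor_abs_rpow hq (x i)).trans Nat.lt_two_pow_self.le
      simpa [Nat.cast_natAbs] using (Nat.cast_le (α := ℝ)).2 hnat
    calc (x i : ℝ) ^ 2 = |(x i : ℝ)| ^ 2 := (sq_abs _).symm
      _ ≤ (2 ^ ⌊|(x i : ℝ)| ^ q⌋₊) ^ 2 := by gcongr
      _ = 4 ^ ⌊|(x i : ℝ)| ^ q⌋₊ := by rw [pow_right_comm]; norm_num
  · simp [show x i = 0 by omega]

lemma expect_tailSum_le (hq : 1 ≤ q) (hn : 0 ≤ n) (hK : n / Fintype.card ι ≤ 1 / 16) :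
    𝔼 x ∈ powBall ι q n, tailSum q x ≤ 256 * (n / Fintype.card ι) * n := by
  have hcoord (i : ι) : 𝔼 x ∈ powBall ι q n, (if 2 ≤ (x i).natAbs then |(x i : ℝ)| ^ q else 0)
      ≤ 256 * (n / Fintype.card ι) ^ 2 := by
    refine (expect_le_expect fun x _ => ?_).trans
      ((expect_exp_coord_le hq hn hK i 2).trans_eq (by ring))
    split_ifs
    · have hpow : (⌊|(x i : ℝ)| ^ q⌋₊ : ℝ) + 1 ≤ 4 ^ ⌊|(x i : ℝ)| ^ q⌋₊ :=
        mod_cast Nat.lt_pow_self (by norm_num)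
      exact (Nat.lt_floor_add_one _).le.trans hpow
    · rfl
  simp only [tailSum]
  rw [expect_sum_comm]
  refine (sum_le_card_nsmul _ _ _ fun i _ => hcoord i).trans_eq ?_
  rw [card_univ, nsmul_eq_mul]
  field_simp

lemma card_few_ones_le (hq : 1 ≤ q) (hn : 4 ≤ n) (hK : n / Fintype.card ι ≤ 1 / 16) :
    (#{x ∈ powBall ι q n | (#(ones x) : ℝ) < n / 2} : ℝ)
      ≤ 1026 * (n / Fintype.card ι) * #(powBall ι q n) := by
  set B := powBall ι q n
  have hn0 : 0 < n := by linarith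
  have htail0 (x : ι → ℤ) : 0 ≤ tailSum q x := sum_nonneg fun i _ => by split_ifs <;> positivity
  have hsub : {x ∈ B | (#(ones x) : ℝ) < n / 2}
      ⊆ powBall ι q (n - (1 : ℕ)) ∪ {x ∈ B | n / 4 ≤ tailSum q x} := by
    intro x hx
    rw [mem_filter] at hx
    rw [mem_union, mem_powBall hq, mem_filter, powSum_eq_card_ones_add_tailSum hq, Nat.cast_one]
    by_contra! hcon
    linarith [hcon.1, hcon.2 hx.1, hx.2]
  have hmarkov : n / 4 * #{x ∈ B | n / 4 ≤ tailSum q x} ≤ ∑ x ∈ B, tailSum q x := by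
    rw [mul_comm, ← nsmul_eq_mul]
    exact (card_nsmul_le_sum _ _ _ fun x hx => (mem_filter.1 hx).2).trans
      (sum_le_sum_of_subset_of_nonneg (filter_subset _ _) fun x _ _ => htail0 x)
  have hmean : ∑ x ∈ B, tailSum q x ≤ #B * (256 * (n / Fintype.card ι) * n) := by
    rw [← card_smul_expect, nsmul_eq_mul]
    gcongr
    exact expect_tailSum_le hq hn0.le hK
  have htail : (#{x ∈ B | n / 4 ≤ tailSum q x} : ℝ) ≤ 1024 * (n / Fintype.card ι) * #B :=
    le_of_mul_le_mul_left (by linarith [hmarkov.trans hmean]) hn0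
  have hinner : (#(powBall ι q (n - (1 : ℕ))) : ℝ) ≤ 2 * (n / Fintype.card ι) * #B := by
    simpa only [pow_one] using card_powBall_sub_nat_le hq hn0.le (hK.trans (by norm_num)) 1
  calc (#{x ∈ B | (#(ones x) : ℝ) < n / 2} : ℝ)
      ≤ #(powBall ι q (n - (1 : ℕ))) + #{x ∈ B | n / 4 ≤ tailSum q x} :=
        Nat.cast_add (R := ℝ) _ _ ▸
          Nat.cast_le.2 ((card_le_card hsub).trans (card_union_le _ _))
    _ ≤ 1026 * (n / Fintype.card ι) * #B := by linarith

end Counting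

section Averaging

lemma expect_smul_eq_expect {G X : Type*} [Group G] [Fintype G] [Fintype X] [MulAction G X]
    [MulAction.IsPretransitive G X] (f : X → ℝ) (x : X) :
    𝔼 g : G, f (g • x) = 𝔼 y, f y := by
  have : Nonempty X := ⟨x⟩
  have horbit (y : X) : 𝔼 g : G, f (g • y) = 𝔼 g : G, f (g • x) := by
    obtain ⟨h, rfl⟩ := MulAction.exists_smul_eq G x y
    exact Fintype.expect_equiv (Equiv.mulRight h) _ _ fun g => by simp [mul_smul]
  calc 𝔼 g : G, f (g • x) = 𝔼 y : X, 𝔼 g : G, f (g • y) := by simp [horbit]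
    _ = 𝔼 g : G, 𝔼 y : X, f (g • y) := expect_comm _ _ _
    _ = 𝔼 _g : G, 𝔼 y, f y :=
        expect_congr rfl fun g _ => Fintype.expect_equiv (MulAction.toPerm g) _ _ fun _ => rfl
    _ = 𝔼 y, f y := expect_const univ_nonempty _

lemma expect_prod_mul_eq_expect_prod_midpoint {κ X 𝕜 : Type*} [Field 𝕜] [CharZero 𝕜]
    {B : Finset X} {J : Finset κ} {T : κ → Equiv.Perm X} {p p' : κ → X → 𝕜} {r : X → 𝕜}
    (hB : ∀ i ∈ J, ∀ x, x ∈ B ↔ T i x ∈ B) (hpT : ∀ i ∈ J, ∀ x, p i (T i x) = p' i x)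
    (hp : ∀ i ∈ J, ∀ j ∈ J, i ≠ j → ∀ x, p j (T i x) = p j x)
    (hp' : ∀ i ∈ J, ∀ j ∈ J, i ≠ j → ∀ x, p' j (T i x) = p' j x)
    (hr : ∀ i ∈ J, ∀ x, r (T i x) = r x) :
    𝔼 x ∈ B, (∏ i ∈ J, p i x) * r x = 𝔼 x ∈ B, (∏ i ∈ J, (p i x + p' i x) / 2) * r x := by
  classical
  induction J using Finset.induction_on generalizing r with
  | empty => simp
  | insert k J hk ih =>
    simp only [forall_mem_insert] at hB hpT hp hp' hr
    have hne : ∀ i ∈ J, i ≠ k := fun i hi h => hk (h ▸ hi)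
    set A : X → 𝕜 := fun x => ∏ i ∈ J, (p i x + p' i x) / 2
    have hA (x : X) : A (T k x) = A x := prod_congr rfl fun i hi => by
      rw [hp.1.2 i hi (hne i hi).symm, hp'.1.2 i hi (hne i hi).symm]
    have hflip : 𝔼 x ∈ B, A x * (p' k x * r x) = 𝔼 x ∈ B, A x * (p k x * r x) :=
      expect_equiv (T k) (hB.1) fun x _ => by rw [hA, hpT.1, hr.1]
    calc 𝔼 x ∈ B, (∏ i ∈ insert k J, p i x) * r x
        = 𝔼 x ∈ B, (∏ i ∈ J, p i x) * (p k x * r x) :=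
          expect_congr rfl fun x _ => by rw [prod_insert hk]; ring
      _ = 𝔼 x ∈ B, A x * (p k x * r x) :=
          ih hB.2 hpT.2 (fun i hi => (hp.2 i hi).2) (fun i hi => (hp'.2 i hi).2) fun i hi x => by
            rw [(hp.2 i hi).1 (hne i hi), hr.2 i hi]
      _ = (𝔼 x ∈ B, A x * (p k x * r x) + 𝔼 x ∈ B, A x * (p' k x * r x)) / 2 := by
          rw [hflip]; ring
      _ = 𝔼 x ∈ B, (∏ i ∈ insert k J, (p i x + p' i x) / 2) * r x := by
          rw [← expect_add_distrib, expect_div]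
          exact expect_congr rfl fun x _ => by rw [prod_insert hk]; ring

lemma abs_expect_le_one {X : Type*} {B : Finset X} (hB : B.Nonempty) {f : X → ℝ}
    (hf : ∀ x, |f x| ≤ 1) : |𝔼 x ∈ B, f x| ≤ 1 :=
  (abs_expect_le _ _).trans (expect_le hB fun x _ => hf x)

lemma abs_sub_expect_mul_le {X : Type*} {B : Finset X} (hB : B.Nonempty) {f : X → ℝ}
    (hf : ∀ x, |f x| ≤ 1) (a : ℝ) {b : ℝ} (hb : 0 ≤ b) : |a - (𝔼 x ∈ B, f x) * b| ≤ |a| + b := by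
  refine (abs_sub _ _).trans (add_le_add_right ?_ _)
  rw [abs_mul, abs_of_nonneg hb]
  exact mul_le_of_le_one_left hb (abs_expect_le_one hB hf)

end Averaging

section Permutations

open Equiv

variable {α : Type*} [Fintype α]

/-- The mean of `w u v` over the ordered pairs `(u, v)` of distinct points. -/
def pairMean (w : α → α → ℝ) : ℝ := 𝔼 ι : Fin 2 ↪ α, w (ι 0) (ι 1)

lemma pairMean_mul (hd : 2 ≤ Fintype.card α) (w : α → α → ℝ) :
    pairMean w * (Fintype.card α * (Fintype.card α - 1)) = ∑ u, ∑ v, w u v - ∑ u, w u u := by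
  classical
  have hcard : (Fintype.card (Fin 2 ↪ α) : ℝ) = Fintype.card α * (Fintype.card α - 1) := by
    rw [Fintype.card_embedding_eq, Fintype.card_fin, Nat.cast_descFactorial_two]
  have hpos : (Fintype.card (Fin 2 ↪ α) : ℝ) ≠ 0 := by
    rw [hcard]
    have : (2 : ℝ) ≤ Fintype.card α := mod_cast hd
    nlinarith
  have hpairs : ∑ ι : Fin 2 ↪ α, w (ι 0) (ι 1) = ∑ p ∈ (univ : Finset α).offDiag, w p.1 p.2 := by
    calc ∑ ι : Fin 2 ↪ α, w (ι 0) (ι 1)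
        = ∑ p : {p : α × α | p.1 ≠ p.2}, w p.1.1 p.1.2 :=
          Fintype.sum_equiv Function.Embedding.twoEmbeddingEquiv _ _ fun _ => rfl
      _ = ∑ p ∈ (univ : Finset α).offDiag, w p.1 p.2 :=
          (sum_subtype _ (by simp) fun p : α × α => w p.1 p.2).symm
  have hsplit := sum_union (f := fun p : α × α => w p.1 p.2) (disjoint_diag_offDiag univ)
  rw [diag_union_offDiag, sum_product, sum_diag] at hsplit
  rw [pairMean, Fintype.expect_eq_sum_div_card, ← hcard, div_mul_cancel₀ _ hpos, hpairs]
  linarith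

lemma div_le_pairMean (hd : 4 ≤ Fintype.card α) {a : α → ℝ} {D : ℝ}
    (hsub : D ≤ ∑ u, (1 - a u)) (hadd : D ≤ ∑ u, (1 + a u)) (hD : 0 ≤ D) :
    D / (8 * Fintype.card α) ≤ pairMean fun u v => (1 - a u * a v) / 4 := by
  have hd' : (4 : ℝ) ≤ Fintype.card α := mod_cast hd
  wlog hA : 0 ≤ ∑ u, a u generalizing a
  · simpa using this (a := -a) (by simpa using hadd) (by simpa [← sub_eq_add_neg] using hsub)
      (by simp only [Pi.neg_apply, sum_neg_distrib]; linarith)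
  have hmean := pairMean_mul (by omega) fun u v => (1 - a u * a v) / 4
  have hdiag : ∑ u, (1 - a u * a u) / 4 ≤ (∑ u, (1 - a u)) / 2 := by
    rw [sum_div]
    exact sum_le_sum fun u _ => by nlinarith [sq_nonneg (a u - 1)]
  have hfull : ∑ u, ∑ v, (1 - a u * a v) / 4 = ((Fintype.card α : ℝ) ^ 2 - (∑ u, a u) ^ 2) / 4 := by
    simp only [← sum_div, sum_sub_distrib, ← mul_sum, ← sum_mul]
    simp [sq]
  have hsum : ∑ u, (1 - a u) = Fintype.card α - ∑ u, a u := by simp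
  rw [hfull] at hmean
  rw [hsum] at hsub hdiag
  set d := (Fintype.card α : ℝ)
  set A := ∑ u, a u
  have hd1 : 0 < d * (d - 1) := by nlinarith
  refine le_of_mul_le_mul_right ?_ hd1
  calc D / (8 * d) * (d * (d - 1)) = D * (d - 1) / 8 := by field_simp
    _ ≤ (d - A) * (d + A - 2) / 4 := by nlinarith
    _ ≤ _ := by linarith

lemma sum_two_pairs_le {w : α → α → ℝ} (hw : ∀ u v, 0 ≤ w u v) :
    ∑ ι : Fin 4 ↪ α, w (ι 0) (ι 1) * w (ι 2) (ι 3) ≤ (∑ ι : Fin 2 ↪ α, w (ι 0) (ι 1)) ^ 2 := by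
  classical
  let split : (Fin 4 ↪ α) ↪ (Fin 2 ↪ α) × (Fin 2 ↪ α) :=
    ⟨fun ι => ((Fin.castAddEmb 2).trans ι, (Fin.natAddEmb 2).trans ι), fun ι ι' h =>
      Function.Embedding.ext <| Fin.addCases (m := 2) (n := 2)
        (DFunLike.congr_fun (congrArg Prod.fst h)) (DFunLike.congr_fun (congrArg Prod.snd h))⟩
  let g : (Fin 2 ↪ α) × (Fin 2 ↪ α) → ℝ := fun p => w (p.1 0) (p.1 1) * w (p.2 0) (p.2 1)
  calc ∑ ι : Fin 4 ↪ α, w (ι 0) (ι 1) * w (ι 2) (ι 3) = ∑ p ∈ univ.map split, g p :=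
        by rw [sum_map]; rfl
    _ ≤ ∑ p, g p :=
        sum_le_sum_of_subset_of_nonneg (subset_univ _) fun _ _ _ => mul_nonneg (hw _ _) (hw _ _)
    _ = (∑ ι : Fin 2 ↪ α, w (ι 0) (ι 1)) ^ 2 := by
        rw [sq, sum_mul_sum, Fintype.sum_prod_type]

lemma expect_two_pairs_le (hd : 8 ≤ Fintype.card α) {w : α → α → ℝ} (hw : ∀ u v, 0 ≤ w u v) :
    𝔼 ι : Fin 4 ↪ α, w (ι 0) (ι 1) * w (ι 2) (ι 3)
      ≤ pairMean w ^ 2 * (1 + 8 / Fintype.card α) := by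
  classical
  have hd' : (8 : ℝ) ≤ Fintype.card α := mod_cast hd
  have hcard2 : (Fintype.card (Fin 2 ↪ α) : ℝ) = Fintype.card α * (Fintype.card α - 1) := by
    rw [Fintype.card_embedding_eq, Fintype.card_fin, Nat.cast_descFactorial_two]
  have hcard4 : (Fintype.card (Fin 4 ↪ α) : ℝ) = Fintype.card (Fin 2 ↪ α)
      * ((Fintype.card α - 2) * (Fintype.card α - 3)) := by
    rw [hcard2, Fintype.card_embedding_eq, Fintype.card_fin]
    simp only [Nat.descFactorial_succ, Nat.descFactorial_zero, Nat.sub_zero]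
    push_cast [Nat.cast_sub (by omega : 3 ≤ Fintype.card α),
      Nat.cast_sub (by omega : 2 ≤ Fintype.card α), Nat.cast_sub (by omega : 1 ≤ Fintype.card α)]
    ring
  rw [pairMean, Fintype.expect_eq_sum_div_card, Fintype.expect_eq_sum_div_card, hcard4, hcard2]
  set d := (Fintype.card α : ℝ)
  set S := ∑ ι : Fin 2 ↪ α, w (ι 0) (ι 1)
  have hpairs : 0 < d * (d - 1) := by nlinarith
  have hrest : 0 < (d - 2) * (d - 3) := by nlinarith
  have hratio : d * (d - 1) ≤ (d - 2) * (d - 3) * (1 + 8 / d) := by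
    have hgap : (d - 2) * (d - 3) * (1 + 8 / d) - d * (d - 1) = (4 * d ^ 2 - 34 * d + 48) / d := by
      field_simp; ring
    have : 0 ≤ (4 * d ^ 2 - 34 * d + 48) / d := div_nonneg (by nlinarith) (by linarith)
    linarith
  calc (∑ ι : Fin 4 ↪ α, w (ι 0) (ι 1) * w (ι 2) (ι 3)) / (d * (d - 1) * ((d - 2) * (d - 3)))
      ≤ S ^ 2 / (d * (d - 1) * ((d - 2) * (d - 3))) := by gcongr; exact sum_two_pairs_le hw
    _ = (S / (d * (d - 1))) ^ 2 * (d * (d - 1) / ((d - 2) * (d - 3))) := by field_simp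
    _ ≤ (S / (d * (d - 1))) ^ 2 * (1 + 8 / d) := by
        gcongr
        rw [div_le_iff₀ hrest]
        linarith

variable [DecidableEq α]

lemma expect_perm_smul_embedding {k : ℕ} (f : (Fin k ↪ α) → ℝ) (ι : Fin k ↪ α) :
    𝔼 σ : Perm α, f (σ • ι) = 𝔼 ι', f ι' :=
  have : MulAction.IsPretransitive (Perm α) (Fin k ↪ α) := ⟨Perm.exists_smul_eq_embedding⟩
  expect_smul_eq_expect f ι

lemma expect_perm_pair (w : α → α → ℝ) {i j : α} (hij : i ≠ j) :
    𝔼 σ : Perm α, w (σ i) (σ j) = pairMean w :=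
  expect_perm_smul_embedding (fun ι => w (ι 0) (ι 1)) (Function.Embedding.embFinTwo hij)

lemma expect_perm_two_pairs_le (hd : 8 ≤ Fintype.card α) {w : α → α → ℝ}
    (hw : ∀ u v, 0 ≤ w u v) {i j k l : α} (hinj : Function.Injective ![i, j, k, l]) :
    𝔼 σ : Perm α, w (σ i) (σ j) * w (σ k) (σ l)
      ≤ pairMean w ^ 2 * (1 + 8 / Fintype.card α) :=
  (expect_perm_smul_embedding (fun ι : Fin 4 ↪ α => w (ι 0) (ι 1) * w (ι 2) (ι 3))
    ⟨_, hinj⟩).trans_le (expect_two_pairs_le hd hw)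

lemma expect_perm_sq_sum_pairs_le (hd : 8 ≤ Fintype.card α) {w : α → α → ℝ}
    (hw : ∀ u v, 0 ≤ w u v) (hw1 : ∀ u v, w u v ≤ 1) {J : Finset α} {φ : α → α}
    (hφ : Set.InjOn φ J) (hJ : ∀ i ∈ J, φ i ∉ J) :
    𝔼 σ : Perm α, (∑ i ∈ J, w (σ i) (σ (φ i))) ^ 2
      ≤ (#J * pairMean w) ^ 2 * (1 + 8 / Fintype.card α) + #J * pairMean w := by
  have hne : ∀ i ∈ J, i ≠ φ i := fun i hi h => hJ i hi (h ▸ hi)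
  have : 0 ≤ pairMean w := expect_nonneg fun _ _ => hw _ _
  set off := pairMean w ^ 2 * (1 + 8 / Fintype.card α)
  have hoff : 0 ≤ off := by positivity
  have hterm : ∀ i ∈ J, ∀ j ∈ J, 𝔼 σ : Perm α, w (σ i) (σ (φ i)) * w (σ j) (σ (φ j))
      ≤ off + if i = j then pairMean w else 0 := by
    intro i hi j hj
    split_ifs with hij
    · subst hij
      rw [← expect_perm_pair w (hne i hi)]
      exact (expect_le_expect fun σ _ => mul_le_of_le_one_left (hw _ _) (hw1 _ _)).trans
        (le_add_of_nonneg_left hoff)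
    · rw [add_zero]
      refine expect_perm_two_pairs_le hd hw ?_
      have := hne i hi
      have := hne j hj
      have hφij : φ i ≠ φ j := fun h => hij (hφ hi hj h)
      have hij' : φ i ≠ j := fun h => hJ i hi (h ▸ hj)
      have hji' : φ j ≠ i := fun h => hJ j hj (h ▸ hi)
      intro a b hab
      fin_cases a <;> fin_cases b <;> simp_all [eq_comm]
  calc 𝔼 σ : Perm α, (∑ i ∈ J, w (σ i) (σ (φ i))) ^ 2
      = ∑ i ∈ J, ∑ j ∈ J, 𝔼 σ : Perm α, w (σ i) (σ (φ i)) * w (σ j) (σ (φ j)) := by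
        simp only [sq, sum_mul_sum, expect_sum_comm]
    _ ≤ ∑ i ∈ J, ∑ j ∈ J, (off + if i = j then pairMean w else 0) :=
        sum_le_sum fun i hi => sum_le_sum fun j hj => hterm i hi j hj
    _ = #J * (#J * off) + #J * pairMean w := by
        simp [sum_add_distrib, sum_ite_mem]
    _ = _ := by ring

lemma expect_perm_sq_sum_pairs_sub_le (hd : 8 ≤ Fintype.card α) {w : α → α → ℝ}
    (hw : ∀ u v, 0 ≤ w u v) (hw1 : ∀ u v, w u v ≤ 1) {J : Finset α} {φ : α → α}
    (hφ : Set.InjOn φ J) (hJ : ∀ i ∈ J, φ i ∉ J) {m : ℝ} (hm : m = #J * pairMean w) :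
    𝔼 σ : Perm α, (∑ i ∈ J, w (σ i) (σ (φ i)) - m) ^ 2 ≤ m + 8 * m ^ 2 / Fintype.card α := by
  have hne : ∀ i ∈ J, i ≠ φ i := fun i hi h => hJ i hi (h ▸ hi)
  set W : Perm α → ℝ := fun σ => ∑ i ∈ J, w (σ i) (σ (φ i))
  have hmean : 𝔼 σ, W σ = m := by
    rw [expect_sum_comm, sum_congr rfl fun i hi => expect_perm_pair w (hne i hi),
      sum_const, nsmul_eq_mul, hm]
  have hsq := expect_perm_sq_sum_pairs_le hd hw hw1 hφ hJ
  rw [← hm] at hsq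
  calc 𝔼 σ, (W σ - m) ^ 2 = 𝔼 σ, (W σ ^ 2 - 2 * m * W σ + m ^ 2) := by
        congr! 2; ring
    _ = 𝔼 σ, W σ ^ 2 - m ^ 2 := by
        rw [expect_add_distrib, expect_sub_distrib, ← mul_expect, hmean,
          expect_const univ_nonempty]
        ring
    _ ≤ m ^ 2 * (1 + 8 / Fintype.card α) + m - m ^ 2 := by gcongr
    _ = m + 8 * m ^ 2 / Fintype.card α := by ring

lemma exp_neg_le_add_sq {m W : ℝ} (hm : 0 < m) (hW : 0 ≤ W) :
    Real.exp (-W) ≤ 2 / m + 4 / m ^ 2 * (W - m) ^ 2 := by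
  rcases le_total (m / 2) W with h | h
  · have hexp : Real.exp (-W) ≤ 2 / m := by
      rw [Real.exp_neg, ← inv_div]
      exact inv_anti₀ (by positivity) (by linarith [Real.add_one_le_exp W])
    exact hexp.trans (le_add_of_nonneg_right (by positivity))
  · have hsq : 1 ≤ 4 / m ^ 2 * (W - m) ^ 2 := by
      rw [div_mul_eq_mul_div, one_le_div (by positivity)]
      nlinarith
    exact (Real.exp_le_one_iff.2 (by linarith)).trans
      (hsq.trans (le_add_of_nonneg_left (by positivity)))

lemma expect_perm_exp_neg_sum_pairs_le (hd : 8 ≤ Fintype.card α) {w : α → α → ℝ}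
    (hw : ∀ u v, 0 ≤ w u v) (hw1 : ∀ u v, w u v ≤ 1) {J : Finset α} {φ : α → α}
    (hφ : Set.InjOn φ J) (hJ : ∀ i ∈ J, φ i ∉ J) {m : ℝ} (hm : m = #J * pairMean w)
    (hm0 : 0 < m) :
    𝔼 σ : Perm α, Real.exp (-∑ i ∈ J, w (σ i) (σ (φ i))) ≤ 6 / m + 32 / Fintype.card α := by
  have : (0 : ℝ) < Fintype.card α := mod_cast (by omega : 0 < Fintype.card α)
  calc 𝔼 σ : Perm α, Real.exp (-∑ i ∈ J, w (σ i) (σ (φ i)))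
      ≤ 𝔼 σ : Perm α, (2 / m + 4 / m ^ 2 * (∑ i ∈ J, w (σ i) (σ (φ i)) - m) ^ 2) :=
        expect_le_expect fun σ _ => exp_neg_le_add_sq hm0 (sum_nonneg fun _ _ => hw _ _)
    _ = 2 / m + 4 / m ^ 2 * 𝔼 σ : Perm α, (∑ i ∈ J, w (σ i) (σ (φ i)) - m) ^ 2 := by
        rw [expect_add_distrib, ← mul_expect, expect_const univ_nonempty]
    _ ≤ 2 / m + 4 / m ^ 2 * (m + 8 * m ^ 2 / Fintype.card α) := by
        gcongr; exact expect_perm_sq_sum_pairs_sub_le hd hw hw1 hφ hJ hm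
    _ = 6 / m + 32 / Fintype.card α := by field_simp; ring

-- Symmetrize over the transpositions of `i` and `φ i`, `i ∈ J`.
lemma expect_perm_prod_eq_expect_prod_midpoint {f : α → α → ℝ} {a : α → ℝ} {φ : α → α}
    {J : Finset α} (hφ : Set.InjOn φ J) (hJ : ∀ i ∈ J, φ i ∉ J)
    (hfa : ∀ i ∈ J, ∀ u, f i u = a u) (hf1 : ∀ i ∈ J, ∀ u, f (φ i) u = 1) :
    𝔼 σ : Perm α, ∏ i, f i (σ i)
      = 𝔼 σ : Perm α, (∏ i ∈ J, (a (σ i) + a (σ (φ i))) / 2) * ∏ i ∈ Jᶜ, f i (σ i) := by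
  have hsep : ∀ i ∈ J, ∀ j ∈ J, φ i ≠ j := fun i hi j hj h => hJ i hi (h ▸ hj)
  calc 𝔼 σ : Perm α, ∏ i, f i (σ i)
      = 𝔼 σ : Perm α, (∏ i ∈ J, a (σ i)) * ∏ i ∈ Jᶜ, f i (σ i) :=
        expect_congr rfl fun σ _ => by
          rw [← prod_mul_prod_compl J, prod_congr rfl fun i hi => hfa i hi _]
    _ = _ := by
        refine expect_prod_mul_eq_expect_prod_midpoint
          (T := fun i => Equiv.mulRight (swap i (φ i))) (by simp) (by simp) ?_ ?_ ?_
        · intro i hi j hj hij σ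
          simp [swap_apply_of_ne_of_ne hij.symm (hsep i hi j hj).symm]
        · intro i hi j hj hij σ
          simp [swap_apply_of_ne_of_ne (hsep j hj i hi) fun h => hij (hφ hi hj h.symm)]
        · intro i hi σ
          refine prod_congr rfl fun j hj => ?_
          rcases eq_or_ne j (φ i) with rfl | hjφ
          · rw [hf1 i hi, hf1 i hi]
          · have hji : j ≠ i := fun h => mem_compl.1 hj (h ▸ hi)
            simp [swap_apply_of_ne_of_ne hji hjφ]

lemma abs_midpoint_le_exp {a b : ℝ} (ha : |a| ≤ 1) (hb : |b| ≤ 1) :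
    |(a + b) / 2| ≤ Real.exp (-((1 - a * b) / 4)) := by
  refine le_trans ?_ (Real.add_one_le_exp _)
  have ha2 : a ^ 2 ≤ 1 := (sq_le_one_iff_abs_le_one a).2 ha
  have hb2 : b ^ 2 ≤ 1 := (sq_le_one_iff_abs_le_one b).2 hb
  rw [abs_le]
  constructor <;> nlinarith [sq_nonneg (a + b - 2), sq_nonneg (a + b + 2)]

lemma abs_expect_perm_prod_le (hd : 8 ≤ Fintype.card α) {f : α → α → ℝ} {a : α → ℝ}
    (ha : ∀ u, |a u| ≤ 1) (hf : ∀ i u, |f i u| ≤ 1) {φ : α → α} {J : Finset α}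
    (hφ : Set.InjOn φ J) (hJ : ∀ i ∈ J, φ i ∉ J) (hfa : ∀ i ∈ J, ∀ u, f i u = a u)
    (hf1 : ∀ i ∈ J, ∀ u, f (φ i) u = 1) {D : ℝ} (hsub : D ≤ ∑ u, (1 - a u))
    (hadd : D ≤ ∑ u, (1 + a u)) (hD : 0 < D) (hJ0 : J.Nonempty) :
    |𝔼 σ : Perm α, ∏ i, f i (σ i)| ≤ 48 * Fintype.card α / (#J * D) + 32 / Fintype.card α := by
  have : (0 : ℝ) < Fintype.card α := mod_cast (by omega : 0 < Fintype.card α)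
  have : (0 : ℝ) < #J := mod_cast hJ0.card_pos
  set w : α → α → ℝ := fun u v => (1 - a u * a v) / 4 with hw
  have hprod (u v : α) : |a u * a v| ≤ 1 := by
    rw [abs_mul]; exact mul_le_one₀ (ha u) (abs_nonneg _) (ha v)
  have hw0 (u v : α) : 0 ≤ w u v := by simp only [hw]; linarith [(abs_le.1 (hprod u v)).2]
  have hw1 (u v : α) : w u v ≤ 1 := by simp only [hw]; linarith [(abs_le.1 (hprod u v)).1]
  have hmean : #J * D / (8 * Fintype.card α) ≤ #J * pairMean w := by
    rw [mul_div_assoc]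
    gcongr
    exact div_le_pairMean (by omega) hsub hadd hD.le
  have hmean0 : 0 < #J * pairMean w := lt_of_lt_of_le (by positivity) hmean
  rw [expect_perm_prod_eq_expect_prod_midpoint hφ hJ hfa hf1]
  calc |𝔼 σ : Perm α, (∏ i ∈ J, (a (σ i) + a (σ (φ i))) / 2) * ∏ i ∈ Jᶜ, f i (σ i)|
      ≤ 𝔼 σ : Perm α, |(∏ i ∈ J, (a (σ i) + a (σ (φ i))) / 2) * ∏ i ∈ Jᶜ, f i (σ i)| :=
        abs_expect_le _ _
    _ ≤ 𝔼 σ : Perm α, Real.exp (-∑ i ∈ J, w (σ i) (σ (φ i))) := by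
        refine expect_le_expect fun σ _ => ?_
        rw [abs_mul, abs_prod, abs_prod, ← sum_neg_distrib, Real.exp_sum]
        refine (mul_le_of_le_one_right (prod_nonneg fun _ _ => abs_nonneg _)
          (prod_le_one (fun _ _ => abs_nonneg _) fun i _ => hf i _)).trans ?_
        exact prod_le_prod (fun _ _ => abs_nonneg _) fun i _ => abs_midpoint_le_exp (ha _) (ha _)
    _ ≤ 6 / (#J * pairMean w) + 32 / Fintype.card α :=
        expect_perm_exp_neg_sum_pairs_le hd hw0 hw1 hφ hJ rfl hmean0
    _ ≤ 6 / (#J * D / (8 * Fintype.card α)) + 32 / Fintype.card α := by gcongr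
    _ = 48 * Fintype.card α / (#J * D) + 32 / Fintype.card α := by field_simp; ring

end Permutations

section Symmetrization

variable {ι : Type*} [DecidableEq ι] {q n : ℝ}

/-- The reflection of the lattice `ι → ℤ` that changes the sign of the coordinate `i`. -/
def reflect (i : ι) : Equiv.Perm (ι → ℤ) :=
  Function.Involutive.toPerm (fun x => Function.update x i (-x i)) fun x => by simp

lemma reflect_apply (i : ι) (x : ι → ℤ) : reflect i x = Function.update x i (-x i) := rfl

variable [Fintype ι]

lemma mem_powBall_reflect (hq : 1 ≤ q) (i : ι) (x : ι → ℤ) :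
    x ∈ powBall ι q n ↔ reflect i x ∈ powBall ι q n := by
  simp [mem_powBall hq, reflect_apply, powSum_update]

lemma mem_powBall_comp (hq : 1 ≤ q) (σ : Equiv.Perm ι) (x : ι → ℤ) :
    x ∈ powBall ι q n ↔ x ∘ σ ∈ powBall ι q n := by
  rw [mem_powBall hq, mem_powBall hq, powSum, powSum,
    ← Equiv.sum_comp σ fun i => |(x i : ℝ)| ^ q]
  rfl

lemma expect_powBall_prod (hq : 1 ≤ q) (F : ι → ℤ → ℂ) :
    𝔼 x ∈ powBall ι q n, ∏ i, F i (x i)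
      = 𝔼 x ∈ powBall ι q n, ∏ i, (F i (x i) + F i (-x i)) / 2 := by
  have hreflect {i j : ι} (hij : i ≠ j) (x : ι → ℤ) : reflect i x j = x j :=
    Function.update_of_ne hij.symm _ _
  simpa using expect_prod_mul_eq_expect_prod_midpoint (B := powBall ι q n) (J := univ)
    (T := reflect) (p := fun i x => F i (x i)) (p' := fun i x => F i (-x i)) (r := fun _ => 1)
    (fun i _ => mem_powBall_reflect hq i) (fun i _ x => by simp [reflect_apply])
    (fun i _ j _ hij x => by rw [hreflect hij]) (fun i _ j _ hij x => by rw [hreflect hij])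
    (fun _ _ _ => rfl)

lemma expect_powBall_eq_expect_expect_perm (hq : 1 ≤ q) (F : (ι → ℤ) → ℝ) :
    𝔼 x ∈ powBall ι q n, F x = 𝔼 x ∈ powBall ι q n, 𝔼 σ : Equiv.Perm ι, F (x ∘ σ.symm) := by
  have hperm (σ : Equiv.Perm ι) :
      𝔼 x ∈ powBall ι q n, F (x ∘ σ.symm) = 𝔼 x ∈ powBall ι q n, F x :=
    expect_equiv (σ.arrowCongr (Equiv.refl ℤ)) (mem_powBall_comp hq σ.symm) fun _ _ => rfl
  rw [expect_comm, expect_congr rfl fun σ _ => hperm σ, expect_const univ_nonempty]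

variable {d : ℕ} {t : ℝ}

lemma latticeBall_eq_powBall (hq : 1 ≤ q) : latticeBall q d t = powBall (Fin d) q (t ^ q) :=
  Set.ext fun _ => (mem_powBall hq).symm

lemma latticeBall_average_eq_expect (hq : 1 ≤ q) (f : (Fin d → ℤ) → ℂ) :
    1 / ((latticeBall q d t).ncard : ℂ) * ∑ᶠ x ∈ latticeBall q d t, f x
      = 𝔼 x ∈ powBall (Fin d) q (t ^ q), f x := by
  rw [latticeBall_eq_powBall hq, finsum_mem_coe_finset, Set.ncard_coe_finset, one_div_mul_eq_div,
    expect_eq_sum_div_card]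

/-- The product `∏ cos (2π x_i ξ_i)`, the average of `e(y · ξ)` over the points `y` obtained from
`x` by changes of sign. -/
def cosProd (ξ : Fin d → ℝ) (x : Fin d → ℤ) : ℝ := ∏ i, Real.cos (2 * Real.pi * x i * ξ i)

lemma abs_cosProd_le_one (ξ : Fin d → ℝ) (x : Fin d → ℤ) : |cosProd ξ x| ≤ 1 := by
  rw [cosProd, abs_prod]
  exact prod_le_one (fun _ _ => abs_nonneg _) fun _ _ => Real.abs_cos_le_one _

lemma cosProd_comp_symm (ξ : Fin d → ℝ) (x : Fin d → ℤ) (σ : Equiv.Perm (Fin d)) :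
    cosProd ξ (x ∘ σ.symm) = ∏ i, Real.cos (2 * Real.pi * x i * ξ (σ i)) := by
  rw [cosProd, ← Equiv.prod_comp σ]
  simp

lemma mult_eq_expect_cosProd (hq : 1 ≤ q) (ξ : Fin d → ℝ) :
    mult q t ξ = (𝔼 x ∈ powBall (Fin d) q (t ^ q), cosProd ξ x : ℝ) := by
  have hprod (x : Fin d → ℤ) : e (∑ i, (x i : ℝ) * ξ i) = ∏ i, e (x i * ξ i) := by
    simp only [e, ← Complex.exp_sum, Complex.ofReal_sum, mul_sum]
  have heven (j : ℤ) (θ : ℝ) :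
      (e (j * θ) + e ((-j : ℤ) * θ)) / 2 = (Real.cos (2 * Real.pi * j * θ) : ℂ) := by
    rw [Complex.ofReal_cos, Complex.cos, e, e]
    push_cast
    congr 3 <;> ring
  rw [mult, latticeBall_average_eq_expect hq, expect_congr rfl fun x _ => hprod x,
    expect_powBall_prod hq fun i j => e (j * ξ i), Complex.ofReal_expect]
  simp only [heven, cosProd, Complex.ofReal_prod]

lemma lambda2_eq_expect_mul_exp (hq : 1 ≤ q) (ξ : Fin d → ℝ) :
    lambda2 q t ξ = ((𝔼 x ∈ powBall (Fin d) q (t ^ q), (-1) ^ (∑ i, x i))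
      * Real.exp (-(kappa q d t ^ q * tnorm (halfShift ξ) ^ 2)) : ℝ) := by
  rw [lambda2, latticeBall_average_eq_expect hq]
  push_cast
  rfl

end Symmetrization

section Trigonometry

lemma abs_sin_nat_mul_le (n : ℕ) (θ : ℝ) : |Real.sin (n * θ)| ≤ n * |Real.sin θ| := by
  induction n with
  | zero => simp
  | succ n ih =>
    rw [Nat.cast_succ, add_one_mul, Real.sin_add]
    calc |Real.sin (n * θ) * Real.cos θ + Real.cos (n * θ) * Real.sin θ|
        ≤ |Real.sin (n * θ)| * |Real.cos θ| + |Real.cos (n * θ)| * |Real.sin θ| := by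
          rw [← abs_mul, ← abs_mul]; exact abs_add_le _ _
      _ ≤ |Real.sin (n * θ)| * 1 + 1 * |Real.sin θ| := by
          gcongr <;> exact Real.abs_cos_le_one _
      _ ≤ (n + 1) * |Real.sin θ| := by linarith

lemma sin_int_mul_sq_le (j : ℤ) (θ : ℝ) :
    Real.sin (j * θ) ^ 2 ≤ (j : ℝ) ^ 2 * Real.sin θ ^ 2 := by
  rw [← mul_pow, sq_le_sq, abs_mul]
  obtain ⟨k, rfl | rfl⟩ := j.eq_nat_or_neg <;> simpa using abs_sin_nat_mul_le k θ

lemma one_sub_cos_two_mul (θ : ℝ) : 1 - Real.cos (2 * θ) = 2 * Real.sin θ ^ 2 := by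
  rw [Real.cos_two_mul, Real.cos_sq']; ring

lemma abs_one_sub_prod_le {ι : Type*} (s : Finset ι) {c : ι → ℝ} (hc : ∀ i, |c i| ≤ 1) :
    |1 - ∏ i ∈ s, c i| ≤ ∑ i ∈ s, (1 - c i) := by
  classical
  induction s using Finset.induction_on with
  | empty => simp
  | insert i s hi ih =>
    have hci : 0 ≤ 1 - c i := sub_nonneg.2 (abs_le.1 (hc i)).2
    rw [prod_insert hi, sum_insert hi]
    calc |1 - c i * ∏ j ∈ s, c j| = |(1 - c i) + c i * (1 - ∏ j ∈ s, c j)| := by ring_nf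
      _ ≤ |1 - c i| + |c i| * |1 - ∏ j ∈ s, c j| := by
          rw [← abs_mul]; exact abs_add_le _ _
      _ ≤ (1 - c i) + ∑ j ∈ s, (1 - c j) :=
          add_le_add (abs_of_nonneg hci).le
            ((mul_le_of_le_one_left (abs_nonneg _) (hc i)).trans ih)

variable {d : ℕ}

lemma tnorm_sq (ξ : Fin d → ℝ) : tnorm ξ ^ 2 = ∑ j, Real.sin (Real.pi * ξ j) ^ 2 :=
  Real.sq_sqrt (sum_nonneg fun _ _ => sq_nonneg _)

lemma sum_one_sub_cos (ξ : Fin d → ℝ) :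
    ∑ u, (1 - Real.cos (2 * Real.pi * ξ u)) = 2 * tnorm ξ ^ 2 := by
  simp only [tnorm_sq, mul_sum, mul_assoc, one_sub_cos_two_mul]

lemma sum_one_add_cos (ξ : Fin d → ℝ) :
    ∑ u, (1 + Real.cos (2 * Real.pi * ξ u)) = 2 * tnorm (halfShift ξ) ^ 2 := by
  rw [← sum_one_sub_cos]
  refine sum_congr rfl fun u _ => ?_
  rw [halfShift, mul_add, show 2 * Real.pi * (1 / 2) = Real.pi by ring, Real.cos_add_pi,
    sub_neg_eq_add]

lemma abs_one_sub_cosProd_le (ξ : Fin d → ℝ) (x : Fin d → ℤ) :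
    |1 - cosProd ξ x| ≤ ∑ i, 2 * Real.sin (Real.pi * ξ i) ^ 2 * (x i : ℝ) ^ 2 := by
  refine (abs_one_sub_prod_le univ fun i => Real.abs_cos_le_one _).trans (sum_le_sum fun i _ => ?_)
  rw [show 2 * Real.pi * x i * ξ i = 2 * (x i * (Real.pi * ξ i)) by ring, one_sub_cos_two_mul]
  linarith [sin_int_mul_sq_le (x i) (Real.pi * ξ i)]

lemma cosProd_eq_neg_one_zpow_mul_cosProd_halfShift (ξ : Fin d → ℝ) (x : Fin d → ℤ) :
    cosProd ξ x = (-1) ^ (∑ i, x i) * cosProd (halfShift ξ) x := by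
  have hsign : (-1 : ℝ) ^ (∑ i, x i) = ∏ i, (-1 : ℝ) ^ x i := by
    induction (univ : Finset (Fin d)) using Finset.induction_on with
    | empty => simp
    | insert i s hi ih => rw [sum_insert hi, prod_insert hi, zpow_add₀ (by norm_num), ih]
  rw [hsign, cosProd, cosProd, ← prod_mul_distrib]
  refine prod_congr rfl fun i _ => ?_
  rw [← Real.cos_sub_int_mul_pi, halfShift]
  ring_nf

end Trigonometry

section Estimates

variable {q n : ℝ} {d : ℕ}

lemma expect_abs_one_sub_cosProd_le [NeZero d] (hq : 1 ≤ q) (hn : 0 ≤ n) (hK : n / d ≤ 1 / 16)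
    (η : Fin d → ℝ) :
    𝔼 x ∈ powBall (Fin d) q n, |1 - cosProd η x| ≤ 64 * (n / d * tnorm η ^ 2) := by
  calc 𝔼 x ∈ powBall (Fin d) q n, |1 - cosProd η x|
      ≤ 𝔼 x ∈ powBall (Fin d) q n, ∑ i, 2 * Real.sin (Real.pi * η i) ^ 2 * (x i : ℝ) ^ 2 :=
        expect_le_expect fun x _ => abs_one_sub_cosProd_le η x
    _ = ∑ i, 2 * Real.sin (Real.pi * η i) ^ 2 * 𝔼 x ∈ powBall (Fin d) q n, (x i : ℝ) ^ 2 := by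
        simp only [expect_sum_comm, mul_expect]
    _ ≤ ∑ i, 2 * Real.sin (Real.pi * η i) ^ 2 * (32 * (n / d)) := by
        gcongr with i
        simpa using expect_sq_coord_le hq hn (by simpa using hK) i
    _ = 64 * (n / d * tnorm η ^ 2) := by
        rw [← sum_mul, ← mul_sum, ← tnorm_sq]; ring

lemma exists_injOn_ones_zeros (hq : 1 ≤ q) {ι : Type*} [Fintype ι] [Nonempty ι] {x : ι → ℤ}
    (hx : 2 * powSum q x ≤ Fintype.card ι) :
    ∃ φ : ι → ι, Set.InjOn φ (ones x) ∧ ∀ i ∈ ones x, x (φ i) = 0 := by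
  have hsupp := card_support_le_powSum hq x
  have hones : #(ones x) ≤ #{i | x i ≠ 0} := card_le_card fun i hi => by
    simp only [ones, mem_filter, mem_univ, true_and] at hi ⊢
    omega
  have hsplit := card_filter_add_card_filter_not (s := univ) fun i => x i = 0
  have hzeros : #(ones x) ≤ #{i | x i = 0} := by
    rw [card_univ] at hsplit
    have : (#{i | x i ≠ 0} : ℝ) * 2 ≤ #{i | x i = 0} + #{i | x i ≠ 0} := by
      rw [← Nat.cast_add, hsplit]; linarith
    have : (#{i | x i ≠ 0} : ℝ) ≤ #{i | x i = 0} := by linarith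
    exact hones.trans (mod_cast this)
  obtain ⟨φ, hmaps, hinj⟩ := (ones x).finite_toSet.exists_injOn_of_encard_le
    (t := {i | x i = 0}) (by
      rw [← coe_filter_univ, Set.encard_coe_eq_coe_finsetCard, Set.encard_coe_eq_coe_finsetCard]
      exact mod_cast hzeros)
  exact ⟨φ, hinj, fun i hi => by simpa using hmaps hi⟩

lemma abs_expect_perm_cosProd_le [NeZero d] (hq : 1 ≤ q) (hn : 4 ≤ n) (hK : n / d ≤ 1 / 16)
    {ξ : Fin d → ℝ} {t : ℝ} (ht : 0 < t) (hξ : t ≤ tnorm ξ) (hξ' : t ≤ tnorm (halfShift ξ))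
    {x : Fin d → ℤ} (hx : powSum q x ≤ n) (hones : n / 2 ≤ #(ones x)) :
    |𝔼 σ : Equiv.Perm (Fin d), cosProd ξ (x ∘ σ.symm)| ≤ 48 / (n / d * t ^ 2) + 8 * (n / d) := by
  have hd0 : (0 : ℝ) < d := mod_cast NeZero.pos d
  have hnd : 16 * n ≤ d := by rw [div_le_iff₀ hd0] at hK; linarith
  obtain ⟨φ, hφ, hzero⟩ := exists_injOn_ones_zeros hq (x := x) (by rw [Fintype.card_fin]; linarith)
  have hone : ∀ i ∈ ones x, (x i).natAbs = 1 := fun i hi => (mem_filter.1 hi).2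
  have hones0 : (0 : ℝ) < #(ones x) := by linarith
  have hd8 : (8 : ℝ) ≤ d := by linarith
  have hperm := abs_expect_perm_prod_le (α := Fin d) (J := ones x) (φ := φ) (D := 2 * t ^ 2)
    (f := fun i u => Real.cos (2 * Real.pi * x i * ξ u))
    (a := fun u => Real.cos (2 * Real.pi * ξ u))
    (hd := by simpa using hd8)
    (ha := fun u => Real.abs_cos_le_one _)
    (hf := fun i u => Real.abs_cos_le_one _)
    (hφ := hφ)
    (hJ := fun i hi h => by simpa [hzero i hi] using hone _ h)
    (hfa := fun i hi u => by rcases Int.natAbs_eq_iff.1 (hone i hi) with h | h <;> simp [h])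
    (hf1 := fun i hi u => by simp [hzero i hi])
    (hsub := by rw [sum_one_sub_cos]; gcongr)
    (hadd := by rw [sum_one_add_cos]; gcongr)
    (hD := by positivity)
    (hJ0 := card_pos.1 (mod_cast hones0))
  simp only [cosProd_comp_symm]
  rw [Fintype.card_fin] at hperm
  calc |𝔼 σ : Equiv.Perm (Fin d), ∏ i, Real.cos (2 * Real.pi * x i * ξ (σ i))|
      ≤ 48 * d / (#(ones x) * (2 * t ^ 2)) + 32 / d := hperm
    _ ≤ 48 * d / (n / 2 * (2 * t ^ 2)) + 8 * n / d := by gcongr; linarith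
    _ = 48 / (n / d * t ^ 2) + 8 * (n / d) := by field_simp

lemma abs_expect_cosProd_le [NeZero d] (hq : 1 ≤ q) (hn : 4 ≤ n) (hK : n / d ≤ 1 / 16)
    {ξ : Fin d → ℝ} {t : ℝ} (ht : 0 < t) (hξ : t ≤ tnorm ξ) (hξ' : t ≤ tnorm (halfShift ξ)) :
    |𝔼 x ∈ powBall (Fin d) q n, cosProd ξ x| ≤ 1034 * (n / d) + 48 / (n / d * t ^ 2) := by
  set B := powBall (Fin d) q n
  have hB : (0 : ℝ) < #B := mod_cast (powBall_nonempty hq (by linarith)).card_pos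
  set b := 48 / (n / d * t ^ 2) + 8 * (n / d)
  have hb : 0 ≤ b := by positivity
  have hterm : ∀ x ∈ B, |𝔼 σ : Equiv.Perm (Fin d), cosProd ξ (x ∘ σ.symm)|
      ≤ b + if (#(ones x) : ℝ) < n / 2 then 1 else 0 := by
    intro x hx
    split_ifs with h
    · exact (abs_expect_le_one univ_nonempty fun σ => abs_cosProd_le_one ξ _).trans
        (le_add_of_nonneg_left hb)
    · rw [add_zero]
      exact abs_expect_perm_cosProd_le hq hn hK ht hξ hξ' ((mem_powBall hq).1 hx) (not_lt.1 h)
  have hfew := card_few_ones_le (ι := Fin d) hq hn (by simpa using hK)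
  rw [Fintype.card_fin] at hfew
  calc |𝔼 x ∈ B, cosProd ξ x|
      = |𝔼 x ∈ B, 𝔼 σ : Equiv.Perm (Fin d), cosProd ξ (x ∘ σ.symm)| := by
        rw [expect_powBall_eq_expect_expect_perm hq]
    _ ≤ 𝔼 x ∈ B, (b + if (#(ones x) : ℝ) < n / 2 then 1 else 0) :=
        (abs_expect_le _ _).trans (expect_le_expect hterm)
    _ = b + #{x ∈ B | (#(ones x) : ℝ) < n / 2} / #B := by
        rw [expect_add_distrib, expect_const (card_pos.1 (mod_cast hB)), expect_eq_sum_div_card,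
          ← natCast_card_filter]
    _ ≤ b + 1026 * (n / d) := by
        gcongr
        exact (div_le_iff₀ hB).2 hfew
    _ = 1034 * (n / d) + 48 / (n / d * t ^ 2) := by ring

lemma exp_neg_le_inv {s : ℝ} (hs : 0 < s) : Real.exp (-s) ≤ s⁻¹ := by
  rw [Real.exp_neg]
  exact inv_anti₀ hs (by linarith [Real.add_one_le_exp s])

variable {ξ η : Fin d → ℝ} {c : (Fin d → ℤ) → ℝ}

lemma abs_expect_cosProd_sub_le_small [NeZero d] (hq : 1 ≤ q) (hn : 0 ≤ n) (hK : n / d ≤ 1 / 16)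
    (hc : ∀ x, |c x| ≤ 1) (hcη : ∀ x, cosProd ξ x = c x * cosProd η x) {s : ℝ}
    (hs : s = n / d * tnorm η ^ 2) :
    |𝔼 x ∈ powBall (Fin d) q n, cosProd ξ x
        - (𝔼 x ∈ powBall (Fin d) q n, c x) * Real.exp (-s)| ≤ 65 * s := by
  have hs0 : 0 ≤ s := by rw [hs]; positivity
  have hterm (x : Fin d → ℤ) :
      |cosProd ξ x - c x * Real.exp (-s)| ≤ |1 - cosProd η x| + s := by
    calc |cosProd ξ x - c x * Real.exp (-s)| = |c x| * |cosProd η x - Real.exp (-s)| := by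
          rw [hcη, ← mul_sub, abs_mul]
      _ ≤ |cosProd η x - Real.exp (-s)| := mul_le_of_le_one_left (abs_nonneg _) (hc x)
      _ ≤ |cosProd η x - 1| + |1 - Real.exp (-s)| := abs_sub_le _ _ _
      _ ≤ |1 - cosProd η x| + s := by
          rw [abs_sub_comm, abs_of_nonneg (sub_nonneg.2 (Real.exp_le_one_iff.2 (by linarith)))]
          linarith [Real.add_one_le_exp (-s)]
  rw [expect_mul, ← expect_sub_distrib]
  calc |𝔼 x ∈ powBall (Fin d) q n, (cosProd ξ x - c x * Real.exp (-s))|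
      ≤ 𝔼 x ∈ powBall (Fin d) q n, (|1 - cosProd η x| + s) :=
        (abs_expect_le _ _).trans (expect_le_expect fun x _ => hterm x)
    _ = 𝔼 x ∈ powBall (Fin d) q n, |1 - cosProd η x| + s := by
        rw [expect_add_distrib, expect_const (powBall_nonempty hq hn)]
    _ ≤ 65 * s := by linarith [hs ▸ expect_abs_one_sub_cosProd_le hq hn hK η]

lemma abs_expect_cosProd_sub_le_large [NeZero d] (hq : 1 ≤ q) (hn : 4 ≤ n) (hK : n / d ≤ 1 / 16)
    (hc : ∀ x, |c x| ≤ 1) (hξ : tnorm η ≤ tnorm ξ) (hξ' : tnorm η ≤ tnorm (halfShift ξ)) {s : ℝ}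
    (hs : s = n / d * tnorm η ^ 2) (hs0 : 0 < s) :
    |𝔼 x ∈ powBall (Fin d) q n, cosProd ξ x
        - (𝔼 x ∈ powBall (Fin d) q n, c x) * Real.exp (-s)| ≤ 1034 * (n / d) + 49 * s⁻¹ := by
  have hη0 : 0 ≤ tnorm η := Real.sqrt_nonneg _
  have hη : 0 < tnorm η := hη0.lt_of_ne' fun h => by rw [hs, h] at hs0; simp at hs0
  calc _ ≤ |𝔼 x ∈ powBall (Fin d) q n, cosProd ξ x| + Real.exp (-s) :=
        abs_sub_expect_mul_le (powBall_nonempty hq (by linarith)) hc _ (Real.exp_pos _).le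
    _ ≤ (1034 * (n / d) + 48 / s) + s⁻¹ := by
        gcongr
        · exact hs ▸ abs_expect_cosProd_le hq hn hK hη hξ hξ'
        · exact exp_neg_le_inv hs0
    _ = 1034 * (n / d) + 49 * s⁻¹ := by ring

lemma abs_expect_cosProd_sub_le [NeZero d] (hq : 1 ≤ q) (hn : 0 < n) (hc : ∀ x, |c x| ≤ 1)
    (hcη : ∀ x, cosProd ξ x = c x * cosProd η x) (hξ : tnorm η ≤ tnorm ξ)
    (hξ' : tnorm η ≤ tnorm (halfShift ξ)) {s : ℝ} (hs : s = n / d * tnorm η ^ 2) :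
    |𝔼 x ∈ powBall (Fin d) q n, cosProd ξ x
        - (𝔼 x ∈ powBall (Fin d) q n, c x) * Real.exp (-s)|
      ≤ 1034 * (min s s⁻¹ + n / d + 1 / n) := by
  have hs0 : 0 ≤ s := by rw [hs]; positivity
  have hmin : 0 ≤ min s s⁻¹ := le_min hs0 (inv_nonneg.2 hs0)
  have hK0 : 0 < n / d := by have := NeZero.pos d; positivity
  have hn0 : 0 < 1 / n := by positivity
  by_cases htriv : 1 / 16 < n / d ∨ n < 4
  · have hB := powBall_nonempty (ι := Fin d) hq hn.le
    calc _ ≤ |𝔼 x ∈ powBall (Fin d) q n, cosProd ξ x| + Real.exp (-s) :=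
          abs_sub_expect_mul_le hB hc _ (Real.exp_pos _).le
      _ ≤ 1 + 1 := by
          gcongr
          · exact abs_expect_le_one hB (abs_cosProd_le_one ξ)
          · exact Real.exp_le_one_iff.2 (by linarith)
      _ ≤ _ := by
          rcases htriv with h | h
          · linarith
          · linarith [one_div_le_one_div_of_le hn h.le]
  push Not at htriv
  obtain ⟨hK, hn4⟩ := htriv
  rcases le_or_gt s s⁻¹ with h | h
  · rw [min_eq_left h] at hmin ⊢
    linarith [abs_expect_cosProd_sub_le_small hq hn.le hK hc hcη hs]
  · have hspos : 0 < s := hs0.lt_of_ne' fun h0 => by simp [h0] at h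
    rw [min_eq_right h.le] at hmin ⊢
    linarith [abs_expect_cosProd_sub_le_large hq hn4 hK hc hξ hξ' hs hspos]

lemma kappa_rpow (hq : 1 ≤ q) {t : ℝ} (ht : 0 ≤ t) : kappa q d t ^ q = t ^ q / d := by
  rw [kappa, Real.div_rpow ht (by positivity), ← Real.rpow_mul (by positivity),
    one_div_mul_cancel (by linarith), Real.rpow_one]

end Estimates

end LqBall

end

open LqBall in
theorem proposition4p3_general :
    ∃ C : ℝ, 0 < C ∧ ∀ (q : ℝ) (d : ℕ) (t : ℝ), 1 ≤ q → 1 ≤ d → 0 < t → ∀ ξ : Fin d → ℝ,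
      (tnorm ξ ≤ tnorm (halfShift ξ) →
        ‖mult q t ξ - lambda1 q t ξ‖ ≤
          C * (min (kappa q d t ^ q * tnorm ξ ^ 2) (kappa q d t ^ q * tnorm ξ ^ 2)⁻¹
            + kappa q d t ^ q + 1 / t ^ q)) ∧
      (tnorm (halfShift ξ) < tnorm ξ →
        ‖mult q t ξ - lambda2 q t ξ‖ ≤
          C * (min (kappa q d t ^ q * tnorm (halfShift ξ) ^ 2)
              (kappa q d t ^ q * tnorm (halfShift ξ) ^ 2)⁻¹
            + kappa q d t ^ q + 1 / t ^ q)) := by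
  refine ⟨1034, by norm_num, fun q d t hq hd ht ξ => ?_⟩
  have : NeZero d := ⟨by omega⟩
  have hn : 0 < t ^ q := Real.rpow_pos_of_pos ht q
  rw [mult_eq_expect_cosProd hq]
  constructor <;> intro h
  · rw [lambda1, ← Complex.ofReal_sub, Complex.norm_real, Real.norm_eq_abs, kappa_rpow hq ht.le]
    simpa [Finset.expect_const (powBall_nonempty hq hn.le)] using
      abs_expect_cosProd_sub_le (c := fun _ => 1) hq hn (by simp) (by simp) le_rfl h rfl
  · rw [lambda2_eq_expect_mul_exp hq, ← Complex.ofReal_sub, Complex.norm_real, Real.norm_eq_abs,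
      kappa_rpow hq ht.le]
    exact abs_expect_cosProd_sub_le hq hn (by simp [abs_zpow])
      (cosProd_eq_neg_one_zpow_mul_cosProd_halfShift ξ) h.le le_rfl rfl

theorem proposition4p3 :
    ∃ C : ℝ, 0 < C ∧
      ∀ (q : ℝ) (d N : ℕ), 1 ≤ q → 1 ≤ d → 1 ≤ N →
        LqBall.kappa q d N ≤ Real.exp (-12 / q) →
        ∀ ξ ∈ LqBall.torus d,
          (LqBall.tnorm ξ ≤ LqBall.tnorm (LqBall.halfShift ξ) →
            ‖LqBall.mult q N ξ - LqBall.lambda1 q N ξ‖ ≤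
              C * (min (LqBall.kappa q d N ^ q * LqBall.tnorm ξ ^ 2)
                    (LqBall.kappa q d N ^ q * LqBall.tnorm ξ ^ 2)⁻¹
                  + LqBall.kappa q d N ^ (q / 50) + 1 / (N : ℝ) ^ q)) ∧
          (LqBall.tnorm (LqBall.halfShift ξ) < LqBall.tnorm ξ →
            ‖LqBall.mult q N ξ - LqBall.lambda2 q N ξ‖ ≤
              C * (min (LqBall.kappa q d N ^ q * LqBall.tnorm (LqBall.halfShift ξ) ^ 2)
                    (LqBall.kappa q d N ^ q * LqBall.tnorm (LqBall.halfShift ξ) ^ 2)⁻¹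
                  + LqBall.kappa q d N ^ (q / 50) + 1 / (N : ℝ) ^ q)) := by
  obtain ⟨C, hC, hbound⟩ := proposition4p3_general
  refine ⟨C, hC, fun q d N hq hd hN hκ ξ _ => ?_⟩
  have hκ0 : 0 < LqBall.kappa q d N := by unfold LqBall.kappa; positivity
  have hκ1 : LqBall.kappa q d N ≤ 1 :=
    hκ.trans (Real.exp_le_one_iff.2 (div_nonpos_of_nonpos_of_nonneg (by norm_num) (by linarith)))
  have hκq : LqBall.kappa q d N ^ q ≤ LqBall.kappa q d N ^ (q / 50) :=
    Real.rpow_le_rpow_of_exponent_ge hκ0 hκ1 (by linarith)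
  obtain ⟨hcase1, hcase2⟩ := hbound q d N hq hd (by positivity) ξ
  exact ⟨fun h => (hcase1 h).trans (by gcongr), fun h => (hcase2 h).trans (by gcongr)⟩
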